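/- Let $d\ge 0$ and $J=\begin{pmatrix}0&I_d\\-I_d&0\end{pmatrix}$. All vector fields are on $\mathbb R^{2d}$; $\phi_h(f,y)$ denotes the exact (local) flow of $\dot y=f(y)$. An integrator $\Phi_h(f,y)$ assigns to each smooth vector field $f$ a one-step map, defined and smooth in $(h,y)$ on an open set containing $\{0\}\times\mathbb R^{2d}$, with an expansion $$\Phi_h(f,y)=y+h\,d_1(f,y)+h^2d_2(f,y)+\cdots\qquad(h\to0),$$ i.e. for every $N$ the difference between $\Phi_h(f,y)$ and the partial sum $y+\sum_{j=1}^N h^jd_j(f,y)$ is $O(h^{N+1})$, where each $d_j(f,y)$ is a smooth function of $y$ and of finitely many derivatives $f(y),f'(y),f''(y),\dots$. It has order $p$ if $\Phi_h(f,y)=\phi_h(f,y)+O(h^{p+1})$ for every smooth $f$ and every $y$. It is symplectic if, whenever $f=J^{-1}\nabla H$ with $H:\mathbb R^{2d}\to\mathbb R$ smooth, its one-step map $g=\Phi_h(f,\cdot)$ satisfies $g'(y)^TJg'(y)=J$ at every $y$ where it is defined. The inverse modified equation of $\dot y=f(y)$ for $\Phi$ is given by the formal series $f_h=f_1+hf_2+h^2f_3+\cdots$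 with smooth vector fields $f_j$ such that $\Phi_h(f_h,y)=\phi_h(f,y)$ as formal power series in $h$; that is, for all $N\ge0$ and all $y$, with $f_h^{[N]}=\sum_{i=1}^{N}h^{i-1}f_i$, $$y+\sum_{j=1}^{N}h^j\,d_j\bigl(f_h^{[N]},y\bigr)=\phi_h(f,y)+O(h^{N+1}).$$ **Theorem.** Let $\Phi$ be a symplectic integrator of order $p\ge1$, and let $H:\mathbb R^{2d}\to\mathbb R$ be smooth. Then the inverse modified equation of $\dot y=J^{-1}\nabla H(y)$ for $\Phi$ exists and is unique as a formal series, and it is again Hamiltonian in the formal sense: there are smooth functions $H_j:\mathbb R^{2d}\to\mathbb R$, $j=1,2,3,\dots$, such that $$f_j(y)=J^{-1}\nabla H_j(y)\qquad\text{for all } j\ge1 \text{ and all } y\in\mathbb R^{2d}.$$ -/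

import Mathlib

open Filter Topology Asymptotics
open scoped ContDiff Matrix Gradient

section OneStepMethods

/-- `γ` is a solution of `ẏ = f(y)`, `γ(0) = y`, on some neighbourhood of time `0`; for small `h`
the value `γ h` is the exact flow `φ_h(f, y)`. -/
def IsLocalSolution {E : Type*} [NormedAddCommGroup E] [NormedSpace ℝ E]
    (f : E → E) (y : E) (γ : ℝ → E) : Prop :=
  γ 0 = y ∧ IsIntegralCurveAt γ (fun _ => f) 0

/-- `D` is a smooth (in general nonlinear) differential operator of finite order on vector fields:
`D(f)(y)` is a smooth function of `y, f(y), f'(y), …, f^{(m)}(y)` for some `m`. -/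
def IsSmoothDiffOperator {E : Type*} [NormedAddCommGroup E] [NormedSpace ℝ E]
    (D : (E → E) → E → E) : Prop :=
  ∃ (m : ℕ) (G : E × ((i : Fin (m + 1)) → E [×(i : ℕ)]→L[ℝ] E) → E),
    ContDiff ℝ ∞ G ∧
      ∀ f : E → E, ContDiff ℝ ∞ f → ∀ y : E,
        D f y = G (y, fun i => iteratedFDeriv ℝ (i : ℕ) f y)

/-- A one-step numerical integrator `y₁ = Φ_h(f, y₀)` on `E`. For a smooth vector field `f` the
one-step map is smooth in `(h, y)` on an open set `dom f` that contains all `(0, y)` (an implicit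
method need only be solvable for small `h`; outside `dom f` the values `step h f y` are
irrelevant), and has the expansion `Φ_h(f, y) = y + h d₁(f, y) + h² d₂(f, y) + ⋯` in powers of
`h`, whose coefficients `d_j(f, y)` are smooth expressions in `f` and its derivatives at `y`. -/
structure Integrator (E : Type*) [NormedAddCommGroup E] [NormedSpace ℝ E] where
  /-- `step h f y` is `Φ_h(f, y)`. -/
  step : ℝ → (E → E) → E → E
  /-- The set of all `(h, y)` for which the step is defined. -/
  dom : (E → E) → Set (ℝ × E)
  /-- `coeff j f y` is `d_j(f, y)`, for `j ≥ 1`. -/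
  coeff : ℕ → (E → E) → E → E
  isOpen_dom : ∀ f : E → E, ContDiff ℝ ∞ f → IsOpen (dom f)
  zero_mem_dom : ∀ f : E → E, ContDiff ℝ ∞ f → ∀ y : E, ((0 : ℝ), y) ∈ dom f
  contDiffOn_step : ∀ f : E → E, ContDiff ℝ ∞ f →
    ContDiffOn ℝ ∞ (fun q : ℝ × E => step q.1 f q.2) (dom f)
  coeff_diffOperator : ∀ j : ℕ, 1 ≤ j → IsSmoothDiffOperator (coeff j)
  expansion : ∀ f : E → E, ContDiff ℝ ∞ f → ∀ (y : E) (N : ℕ),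
    (fun h : ℝ => step h f y - (y + ∑ j ∈ Finset.Icc 1 N, h ^ j • coeff j f y))
      =O[𝓝 0] fun h : ℝ => h ^ (N + 1)

/-- `Φ_h(f, y) = φ_h(f, y) + O(h^{p+1})` for every smooth vector field `f`. -/
def Integrator.HasOrder {E : Type*} [NormedAddCommGroup E] [NormedSpace ℝ E]
    (Φ : Integrator E) (p : ℕ) : Prop :=
  ∀ f : E → E, ContDiff ℝ ∞ f → ∀ (y : E) (γ : ℝ → E), IsLocalSolution f y γ →
    (fun h : ℝ => Φ.step h f y - γ h) =O[𝓝 0] fun h : ℝ => h ^ (p + 1)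

/-- The truncation `f₁ + h f₂ + ⋯ + h^{N-1} f_N`, where `F i` stands for `f_{i+1}`. -/
def truncatedField {E : Type*} [NormedAddCommGroup E] [NormedSpace ℝ E]
    (F : ℕ → E → E) (N : ℕ) (h : ℝ) : E → E :=
  fun z => ∑ i ∈ Finset.range N, h ^ i • F i z

/-- The formal series `f_h = f₁ + h f₂ + h² f₃ + ⋯` (with `F i = f_{i+1}`) of smooth vector fields
is the inverse modified equation of `ẏ = f(y)` for `Φ`: inserting `f_h` into
`y + h d₁(f_h, y) + h² d₂(f_h, y) + ⋯` gives, in every power of `h`, the expansion of the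
exact flow `φ_h(f, y)`. The powers `h^0, …, h^N` only involve `d₁, …, d_N` and `f₁, …, f_N`. -/
structure Integrator.IsInverseModified {E : Type*} [NormedAddCommGroup E] [NormedSpace ℝ E]
    (Φ : Integrator E) (f : E → E) (F : ℕ → E → E) : Prop where
  smooth : ∀ i : ℕ, ContDiff ℝ ∞ (F i)
  matching : ∀ (N : ℕ) (y : E) (γ : ℝ → E), IsLocalSolution f y γ →
    (fun h : ℝ =>
        (y + ∑ j ∈ Finset.Icc 1 N, h ^ j • Φ.coeff j (truncatedField F N h) y) - γ h)
      =O[𝓝 0] fun h : ℝ => h ^ (N + 1)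

end OneStepMethods

section Symplectic

/-- The phase space `ℝ^{2d}`, with its Euclidean inner product. -/
abbrev PhaseSpace (d : ℕ) : Type := EuclideanSpace ℝ (Fin d ⊕ Fin d)

/-- The matrix `J = (0, I_d; -I_d, 0)`. -/
def structureMatrix (d : ℕ) : Matrix (Fin d ⊕ Fin d) (Fin d ⊕ Fin d) ℝ :=
  Matrix.fromBlocks 0 1 (-1) 0

/-- The Hamiltonian vector field `J⁻¹ ∇H`. -/
noncomputable def hamiltonianField {d : ℕ} (H : PhaseSpace d → ℝ) :
    PhaseSpace d → PhaseSpace d :=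
  fun y => Matrix.toEuclideanLin (structureMatrix d)⁻¹ (∇ H y)

/-- The Jacobian matrix `g'(y)`. -/
noncomputable def jacobianMatrix {d : ℕ} (g : PhaseSpace d → PhaseSpace d) (y : PhaseSpace d) :
    Matrix (Fin d ⊕ Fin d) (Fin d ⊕ Fin d) ℝ :=
  Matrix.of fun i j => (fderiv ℝ g y (EuclideanSpace.single j 1)) i

/-- `g` is differentiable on `U` with `g'(y)ᵀ J g'(y) = J` there. It is used for open `U`. -/
def IsSymplecticOn {d : ℕ} (g : PhaseSpace d → PhaseSpace d) (U : Set (PhaseSpace d)) : Prop :=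
  ∀ y ∈ U, DifferentiableAt ℝ g y ∧
    (jacobianMatrix g y)ᵀ * structureMatrix d * jacobianMatrix g y = structureMatrix d

/-- The one-step map is symplectic, where it is defined, whenever the integrator is applied to a
smooth Hamiltonian system. -/
def Integrator.IsSymplectic {d : ℕ} (Φ : Integrator (PhaseSpace d)) : Prop :=
  ∀ H : PhaseSpace d → ℝ, ContDiff ℝ ∞ H → ∀ h : ℝ,
    IsSymplecticOn (Φ.step h (hamiltonianField H)) {y | (h, y) ∈ Φ.dom (hamiltonianField H)}

end Symplectic

/-!
The fields of the inverse modified equation are found one after the other. In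

  `∑ h ^ j d_j(f₁ + h f₂ + ⋯, y)`

the field `f_{M+1}` first occurs in the power `h ^ (M + 1)`, and there only through `d₁`. An
integrator of order at least one has `d₁(f, y) = f(y)`, so the power `h ^ (M + 1)` matches the exact
flow if and only if `f_{M+1}` is the difference of two expressions that involve `f₁, …, f_M` only
(`Integrator.nextField`, `Integrator.matching_succ_iff`). This gives existence and uniqueness.

That the fields are Hamiltonian is proved by induction. If `f₁, …, f_M` are Hamiltonian, then so is
`f₁ + ⋯ + s ^ {M - 1} f_M` for every real `s`, and the one-step map for this field is symplectic.
Hence the expansion of the integrator at this field preserves the symplectic form `Ω` in every power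
of `h` (`Integrator.formCoeff_fderiv_expansionCoeff`). These are identities between the coefficients
`d_j`, smooth in `s`, so they may be used with `s = h`: the modified sum without `f_{M+1}` preserves
`Ω` up to `O(h ^ (M + 2))` (`Integrator.form_dirDeriv_modifiedSum_isBigO`). The exact flow preserves
`Ω` as well. Its derivative with respect to the initial value enters only through solutions of the
variational equation, whose expansion is the derivative of the expansion of the flow
(`fderiv_flowCoeff_expansion`), so smooth dependence of flows on initial values is not needed. Up to
`O(h ^ (M + 2))` the derivatives of the modified sum and of the flow differ by
`h ^ (M + 1) f_{M+1}'`, and comparing the two gives `Ω(f_{M+1}' v, w) + Ω(v, f_{M+1}' w) = 0`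
(`Integrator.form_fderiv_nextField`). By the Poincaré lemma `f_{M+1}` is Hamiltonian
(`exists_eq_hamiltonianField`).
-/

/-! ### Curves and their expansions in powers of the step size -/

section Expansion

variable {V : Type*} [NormedAddCommGroup V] [NormedSpace ℝ V]

theorem isBigO_pow_of_le {m n : ℕ} (hmn : m ≤ n) :
    (fun h : ℝ => h ^ n) =O[𝓝 0] fun h : ℝ => h ^ m := by
  simpa only [← pow_add, Nat.add_sub_cancel' hmn, mul_one] using
    (isBigO_refl (fun h : ℝ => h ^ m) (𝓝 0)).mul
      ((continuous_pow (n - m)).continuousAt.isBigO_one ℝ)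

theorem isBigO_pow_smul {n : ℕ} {c : ℝ → V} (hc : ContinuousAt c 0) :
    (fun h : ℝ => h ^ n • c h) =O[𝓝 0] fun h : ℝ => h ^ n := by
  simpa using (isBigO_refl (fun h : ℝ => h ^ n) (𝓝 0)).smul (hc.isBigO_one ℝ)

theorem eq_zero_of_pow_smul_isLittleO {n : ℕ} {a : V}
    (ha : (fun h : ℝ => h ^ n • a) =o[𝓝 0] fun h : ℝ => h ^ n) : a = 0 := by
  by_contra hne
  have hpos : 0 < ‖a‖ := norm_pos_iff.2 hne
  have h1 := (ha.def (half_pos hpos)).filter_mono (nhdsWithin_le_nhds (s := {0}ᶜ))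
  obtain ⟨h, hh, hh0⟩ := (h1.and self_mem_nhdsWithin).exists
  have hpow : 0 < ‖h ^ n‖ := norm_pos_iff.2 (pow_ne_zero _ hh0)
  rw [norm_smul, mul_comm, mul_le_mul_iff_left₀ hpow] at hh
  linarith

/-- Coefficients of an expansion in powers of `h` are determined by its germ. -/
theorem eq_zero_of_sum_pow_smul_isBigO {N : ℕ} {a : ℕ → V}
    (ha : (fun h : ℝ => ∑ j ∈ Finset.range N, h ^ j • a j) =O[𝓝 0] fun h : ℝ => h ^ N) :
    ∀ j < N, a j = 0 := by
  induction N with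
  | zero => simp
  | succ N ih =>
    have hlow : (fun h : ℝ => ∑ j ∈ Finset.range N, h ^ j • a j) =O[𝓝 0] fun h : ℝ => h ^ N := by
      have := (ha.trans (isBigO_pow_of_le N.le_succ)).sub
        (isBigO_pow_smul (n := N) (c := fun _ => a N) continuousAt_const)
      simpa [Finset.sum_range_succ] using this
    have h0 := ih hlow
    have hN : a N = 0 := by
      refine eq_zero_of_pow_smul_isLittleO (n := N) (IsBigO.trans_isLittleO ?_
        (isLittleO_pow_pow (𝕜 := ℝ) N.lt_succ_self))
      refine ha.congr_left fun h => ?_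
      rw [Finset.sum_range_succ, Finset.sum_eq_zero fun j hj => ?_, zero_add]
      rw [h0 j (Finset.mem_range.1 hj), smul_zero]
    intro j hj
    rcases Nat.lt_succ_iff_lt_or_eq.1 hj with h | rfl
    · exact h0 j h
    · exact hN

/-- A curve vanishing at `0` whose derivative is `O(h ^ n)` is `O(h ^ (n + 1))`. -/
theorem isBigO_pow_succ_of_hasDerivAt {r r' : ℝ → V} {n : ℕ} (h0 : r 0 = 0)
    (hr : ∀ᶠ t in 𝓝 (0 : ℝ), HasDerivAt r (r' t) t)
    (hr' : r' =O[𝓝 0] fun h : ℝ => h ^ n) : r =O[𝓝 0] fun h : ℝ => h ^ (n + 1) := by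
  obtain ⟨C, hC0, hC⟩ := hr'.exists_nonneg
  obtain ⟨ε, hε, hball⟩ := Metric.eventually_nhds_iff_ball.1 (hr.and hC.bound)
  refine IsBigO.of_bound C ?_
  filter_upwards [Metric.ball_mem_nhds (0 : ℝ) hε] with h hh
  have key := (convex_closedBall (0 : ℝ) ‖h‖).norm_image_sub_le_of_norm_hasDerivWithin_le
    (f := r) (f' := r') (C := C * ‖h‖ ^ n) (x := 0) (y := h) ?_ ?_ (by simp) (by simp)
  · simpa [h0, pow_succ, mul_assoc] using key
  · intro t ht
    refine (hball t ?_).1.hasDerivWithinAt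
    simp only [Metric.mem_ball, Metric.mem_closedBall, dist_zero_right] at ht hh ⊢
    exact ht.trans_lt hh
  · intro t ht
    simp only [Metric.mem_ball, Metric.mem_closedBall, dist_zero_right] at ht hh
    have hb := (hball t (by simpa using ht.trans_lt hh)).2
    rw [norm_pow] at hb
    exact hb.trans (by gcongr)

open Nat in
/-- Taylor's formula for a curve `c 0` whose successive derivatives are `c 1, c 2, …`. -/
theorem isBigO_taylor_of_hasDerivAt (N : ℕ) {c : ℕ → ℝ → V}
    (hc : ∀ n, ∀ᶠ t in 𝓝 (0 : ℝ), HasDerivAt (c n) (c (n + 1) t) t) :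
    (fun h : ℝ => c 0 h - ∑ j ∈ Finset.range N, h ^ j • (((j ! : ℕ) : ℝ)⁻¹ • c j 0))
      =O[𝓝 0] fun h : ℝ => h ^ N := by
  induction N generalizing c with
  | zero => simpa using (hc 0).self_of_nhds.continuousAt.isBigO_one ℝ
  | succ N ih =>
    refine isBigO_pow_succ_of_hasDerivAt ?_ ?_ (ih (c := fun n => c (n + 1)) fun n => hc (n + 1))
    · simp [Finset.sum_range_succ']
    · filter_upwards [hc 0] with t ht
      simp only [Finset.sum_range_succ', pow_zero, one_smul]
      have hs : HasDerivAt (fun h : ℝ => ∑ j ∈ Finset.range N,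
          h ^ (j + 1) • ((((j + 1)! : ℕ) : ℝ)⁻¹ • c (j + 1) 0))
          (∑ j ∈ Finset.range N, t ^ j • (((j ! : ℕ) : ℝ)⁻¹ • c (j + 1) 0)) t := by
        refine HasDerivAt.fun_sum fun j _ => ?_
        have := (hasDerivAt_pow (j + 1) t).smul_const ((((j + 1)! : ℕ) : ℝ)⁻¹ • c (j + 1) 0)
        convert this using 1
        simp only [smul_smul, Nat.factorial_succ, add_tsub_cancel_right]
        congr 1
        push_cast
        field_simp
      exact ht.sub (hs.add_const _)

/-- A product of two polynomials in `h` truncated at order `N`, up to a remainder of order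
`N`. -/
theorem sum_sum_pow_mul_isBigO (N : ℕ) {x : ℕ → ℕ → ℝ → ℝ}
    (hx : ∀ i j, ContinuousAt (x i j) 0) :
    (fun h : ℝ => ∑ i ∈ Finset.range N, ∑ j ∈ Finset.range N, h ^ (i + j) * x i j h
      - ∑ n ∈ Finset.range N, h ^ n * ∑ k ∈ Finset.HasAntidiagonal.antidiagonal n, x k.1 k.2 h)
      =O[𝓝 0] fun h : ℝ => h ^ N := by
  have hsplit : ∀ s : ℝ, ∑ i ∈ Finset.range N, ∑ j ∈ Finset.range N, s ^ (i + j) * x i j s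
      - ∑ n ∈ Finset.range N, s ^ n * ∑ k ∈ Finset.HasAntidiagonal.antidiagonal n, x k.1 k.2 s
      = ∑ k ∈ (Finset.range N ×ˢ Finset.range N) with ¬ k.1 + k.2 < N,
          s ^ (k.1 + k.2) * x k.1 k.2 s := by
    intro s
    rw [← Finset.sum_product', ← Finset.sum_filter_add_sum_filter_not _ (fun k => k.1 + k.2 < N),
      add_comm, sub_eq_iff_eq_add, add_right_inj]
    simp_rw [Finset.mul_sum]
    rw [Finset.sum_sigma']
    refine Finset.sum_bij' (fun k _ => ⟨k.1 + k.2, k⟩) (fun k _ => k.2) ?_ ?_ ?_ ?_ ?_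
    · simp
    · rintro ⟨n, i, j⟩ h
      simp only [Finset.mem_sigma, Finset.mem_range, Finset.HasAntidiagonal.mem_antidiagonal] at h
      simp only [Finset.mem_filter, Finset.mem_product, Finset.mem_range]
      omega
    · simp
    · rintro ⟨n, i, j⟩ h
      simp only [Finset.mem_sigma, Finset.mem_range, Finset.HasAntidiagonal.mem_antidiagonal] at h
      obtain ⟨-, rfl⟩ := h
      rfl
    · simp
  simp_rw [hsplit]
  refine IsBigO.fun_sum fun k hk => ?_
  have hk' : N ≤ k.1 + k.2 := by simpa using (Finset.mem_filter.1 hk).2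
  simpa using (isBigO_pow_of_le hk').mul ((hx k.1 k.2).isBigO_one ℝ)

end Expansion

/-! ### Taylor coefficients in the step size of functions of `(h, y)` -/

section TaylorCoeff

variable {E V : Type*} [NormedAddCommGroup E] [NormedSpace ℝ E]
  [NormedAddCommGroup V] [NormedSpace ℝ V]

/-- The derivative of `u(h, y)` in the fixed direction `w` of the `(h, y)`-space. -/
noncomputable def dirDeriv (w : ℝ × E) (u : ℝ × E → V) : ℝ × E → V :=
  fun q => fderiv ℝ u q w

open Nat in
/-- The coefficient of `h ^ n` in the Taylor expansion of `h ↦ u(h, y)` at `h = 0`, as a function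
of `y`. -/
noncomputable def taylorCoeff (n : ℕ) (u : ℝ × E → V) (y : E) : V :=
  ((n ! : ℕ) : ℝ)⁻¹ • ((dirDeriv (1, 0))^[n] u) (0, y)

variable {u : ℝ × E → V} {U : Set (ℝ × E)}

theorem contDiffOn_dirDeriv (hU : IsOpen U) (hu : ContDiffOn ℝ ∞ u U) (w : ℝ × E) :
    ContDiffOn ℝ ∞ (dirDeriv w u) U :=
  ((contDiffOn_infty_iff_fderiv_of_isOpen hU).1 hu).2.clm_apply contDiffOn_const

theorem contDiffOn_iterate_dirDeriv (hU : IsOpen U) (hu : ContDiffOn ℝ ∞ u U) (w : ℝ × E)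
    (n : ℕ) : ContDiffOn ℝ ∞ ((dirDeriv w)^[n] u) U := by
  induction n with
  | zero => exact hu
  | succ n ih =>
    rw [Function.iterate_succ_apply']
    exact contDiffOn_dirDeriv hU ih w

theorem contDiff_taylorCoeff (hu : ContDiff ℝ ∞ u) (n : ℕ) : ContDiff ℝ ∞ (taylorCoeff n u) := by
  have := contDiffOn_univ.1
    (contDiffOn_iterate_dirDeriv isOpen_univ (contDiffOn_univ.2 hu) (1, 0) n)
  exact contDiff_const.smul (this.comp (contDiff_const.prodMk contDiff_id))

theorem hasDerivAt_dirDeriv {h : ℝ} {y : E} (hu : DifferentiableAt ℝ u (h, y)) :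
    HasDerivAt (fun t => u (t, y)) (dirDeriv (1, 0) u (h, y)) h := by
  have h1 : HasDerivAt (fun t : ℝ => (t, y)) ((1 : ℝ), (0 : E)) h :=
    (hasDerivAt_id h).prodMk (hasDerivAt_const h y)
  exact hu.hasFDerivAt.comp_hasDerivAt h h1

theorem hasFDerivAt_slice {h : ℝ} {y : E} (hu : DifferentiableAt ℝ u (h, y)) :
    HasFDerivAt (fun z => u (h, z)) ((fderiv ℝ u (h, y)).comp (.inr ℝ ℝ E)) y :=
  hu.hasFDerivAt.comp y (hasFDerivAt_prodMk_right h y)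

theorem fderiv_slice {h : ℝ} {y : E} (hu : DifferentiableAt ℝ u (h, y)) (v : E) :
    fderiv ℝ (fun z => u (h, z)) y v = dirDeriv (0, v) u (h, y) := by
  rw [(hasFDerivAt_slice hu).fderiv]
  simp [dirDeriv]

theorem taylorCoeff_expansion (hU : IsOpen U) (hu : ContDiffOn ℝ ∞ u U) {y : E}
    (hy : ((0 : ℝ), y) ∈ U) (N : ℕ) :
    (fun h : ℝ => u (h, y) - ∑ j ∈ Finset.range N, h ^ j • taylorCoeff j u y)
      =O[𝓝 0] fun h : ℝ => h ^ N := by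
  refine isBigO_taylor_of_hasDerivAt N
    (c := fun n h => ((dirDeriv (1, 0))^[n] u) (h, y)) fun n => ?_
  have hU' : ∀ᶠ t in 𝓝 (0 : ℝ), (t, y) ∈ U :=
    (Continuous.prodMk_left y).continuousAt.preimage_mem_nhds (hU.mem_nhds hy)
  filter_upwards [hU'] with t ht
  simp only [Function.iterate_succ_apply']
  exact hasDerivAt_dirDeriv (((contDiffOn_iterate_dirDeriv hU hu (1, 0) n).contDiffAt
    (hU.mem_nhds ht)).differentiableAt (by simp))

theorem dirDeriv_comm (hU : IsOpen U) (hu : ContDiffOn ℝ ∞ u U) (v w : ℝ × E) :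
    Set.EqOn (dirDeriv v (dirDeriv w u)) (dirDeriv w (dirDeriv v u)) U := by
  intro q hq
  have hat := hu.contDiffAt (hU.mem_nhds hq)
  have hd : DifferentiableAt ℝ (fderiv ℝ u) q :=
    (((contDiffOn_infty_iff_fderiv_of_isOpen hU).1 hu).2.contDiffAt
      (hU.mem_nhds hq)).differentiableAt (by simp)
  have hsymm : IsSymmSndFDerivAt ℝ u q := hat.isSymmSndFDerivAt (by simpa using ENat.LEInfty.out)
  have key : ∀ v w : ℝ × E, dirDeriv v (dirDeriv w u) q = fderiv ℝ (fderiv ℝ u) q v w := by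
    intro v w
    have := hd.hasFDerivAt.clm_apply (hasFDerivAt_const w q)
    change fderiv ℝ (fun z => fderiv ℝ u z w) q v = _
    rw [this.fderiv]
    simp
  rw [key, key, hsymm.eq]

theorem dirDeriv_eqOn (hU : IsOpen U) {u' : ℝ × E → V} (h : Set.EqOn u u' U) (w : ℝ × E) :
    Set.EqOn (dirDeriv w u) (dirDeriv w u') U := fun q hq => by
  have : u =ᶠ[𝓝 q] u' := eventually_of_mem (hU.mem_nhds hq) h
  simp only [dirDeriv, this.fderiv_eq]

theorem dirDeriv_iterate_comm (hU : IsOpen U) (hu : ContDiffOn ℝ ∞ u U) (v w : ℝ × E) (n : ℕ) :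
    Set.EqOn (dirDeriv v ((dirDeriv w)^[n] u)) ((dirDeriv w)^[n] (dirDeriv v u)) U := by
  induction n with
  | zero => exact fun _ _ => rfl
  | succ n ih =>
    rw [Function.iterate_succ_apply', Function.iterate_succ_apply']
    exact (dirDeriv_comm hU (contDiffOn_iterate_dirDeriv hU hu w n) v w).trans
      (dirDeriv_eqOn hU ih w)

/-- Expansion in `h` commutes with differentiation in `y`. -/
theorem fderiv_taylorCoeff (hU : IsOpen U) (hu : ContDiffOn ℝ ∞ u U) {y : E}
    (hy : ((0 : ℝ), y) ∈ U) (n : ℕ) (v : E) :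
    fderiv ℝ (taylorCoeff n u) y v = taylorCoeff n (dirDeriv (0, v) u) y := by
  have hd : DifferentiableAt ℝ ((dirDeriv (1, 0))^[n] u) ((0 : ℝ), y) :=
    ((contDiffOn_iterate_dirDeriv hU hu (1, 0) n).contDiffAt
      (hU.mem_nhds hy)).differentiableAt (by simp)
  have h1 := (hasFDerivAt_slice hd).const_smul ((n.factorial : ℝ)⁻¹)
  have h2 : fderiv ℝ (taylorCoeff n u) y = _ := h1.fderiv
  rw [h2, taylorCoeff, ← dirDeriv_iterate_comm hU hu (0, v) (1, 0) n hy]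
  simp [dirDeriv]

end TaylorCoeff

/-! ### The expansion of the exact flow -/

section Flow

variable {E V : Type*} [NormedAddCommGroup E] [NormedSpace ℝ E]
  [NormedAddCommGroup V] [NormedSpace ℝ V] {f : E → E}

/-- The Lie derivative `g' f` of `g` along the vector field `f`. -/
noncomputable def lieDeriv (f : E → E) (g : E → V) : E → V :=
  fun y => fderiv ℝ g y (f y)

open Nat in
/-- The coefficient of `h ^ n` in the expansion of the exact flow `φ_h(f, y)`: the `n`-fold Lie
derivative of the identity, divided by `n!`. -/
noncomputable def flowCoeff (f : E → E) (n : ℕ) (y : E) : E :=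
  ((n ! : ℕ) : ℝ)⁻¹ • ((lieDeriv f)^[n] id) y

theorem contDiff_iterate_lieDeriv (hf : ContDiff ℝ ∞ f) (n : ℕ) :
    ContDiff ℝ ∞ ((lieDeriv f)^[n] (id : E → E)) := by
  induction n with
  | zero => exact contDiff_id
  | succ n ih =>
    rw [Function.iterate_succ_apply']
    exact (contDiff_infty_iff_fderiv.1 ih).2.clm_apply hf

theorem contDiff_flowCoeff (hf : ContDiff ℝ ∞ f) (n : ℕ) : ContDiff ℝ ∞ (flowCoeff f n) :=
  contDiff_const.smul (contDiff_iterate_lieDeriv hf n)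

theorem exists_isLocalSolution [CompleteSpace E] (hf : ContDiff ℝ ∞ f) (y : E) :
    ∃ γ : ℝ → E, IsLocalSolution f y γ := by
  obtain ⟨γ, h0, ε, hε, hγ⟩ := (hf.of_le (by simp) : ContDiff ℝ 1 f).contDiffAt
    |>.exists_forall_mem_closedBall_exists_eq_forall_mem_Ioo_hasDerivAt₀ (x₀ := y) 0
  refine ⟨γ, h0, ?_⟩
  filter_upwards [Ioo_mem_nhds (show (0 : ℝ) - ε < 0 by linarith)
    (show (0 : ℝ) < 0 + ε by linarith)] with t ht using hγ t ht

theorem flowCoeff_expansion (hf : ContDiff ℝ ∞ f) {y : E} {γ : ℝ → E}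
    (hγ : IsLocalSolution f y γ) (N : ℕ) :
    (fun h : ℝ => γ h - ∑ j ∈ Finset.range N, h ^ j • flowCoeff f j y)
      =O[𝓝 0] fun h : ℝ => h ^ N := by
  have := isBigO_taylor_of_hasDerivAt N (c := fun n t => ((lieDeriv f)^[n] id) (γ t)) fun n => by
    filter_upwards [hγ.2] with t ht
    simp only [Function.iterate_succ_apply']
    exact (((contDiff_iterate_lieDeriv hf n).differentiable (by simp)) (γ t)).hasFDerivAt
      |>.comp_hasDerivAt t ht
  simpa [flowCoeff, hγ.1] using this

theorem fderiv_lieDeriv {g : E → V} (hf : ContDiff ℝ ∞ f) (hg : ContDiff ℝ ∞ g) (y v : E) :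
    fderiv ℝ (lieDeriv f g) y v
      = fderiv ℝ (fderiv ℝ g) y (f y) v + fderiv ℝ g y (fderiv ℝ f y v) := by
  have hd : DifferentiableAt ℝ (fderiv ℝ g) y :=
    (contDiff_infty_iff_fderiv.1 hg).2.differentiable (by simp) y
  have hsymm : IsSymmSndFDerivAt ℝ g y :=
    hg.contDiffAt.isSymmSndFDerivAt (by simpa using ENat.LEInfty.out)
  have := hd.hasFDerivAt.clm_apply (hf.differentiable (by simp) y).hasFDerivAt
  rw [show fderiv ℝ (lieDeriv f g) y = _ from this.fderiv, hsymm.eq]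
  simp [add_comm]

/-- A solution `X` of the variational equation `Ẋ = f'(γ) X` along the flow line `γ` is the
derivative of the flow with respect to the initial value. Its expansion is obtained by
differentiating that of the flow. -/
theorem fderiv_flowCoeff_expansion (hf : ContDiff ℝ ∞ f) {γ X : ℝ → E}
    (hγ : ∀ᶠ t in 𝓝 (0 : ℝ), HasDerivAt γ (f (γ t)) t)
    (hX : ∀ᶠ t in 𝓝 (0 : ℝ), HasDerivAt X (fderiv ℝ f (γ t) (X t)) t) (N : ℕ) :
    (fun h : ℝ => X h - ∑ j ∈ Finset.range N, h ^ j • fderiv ℝ (flowCoeff f j) (γ 0) (X 0))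
      =O[𝓝 0] fun h : ℝ => h ^ N := by
  have := isBigO_taylor_of_hasDerivAt N
    (c := fun n t => fderiv ℝ ((lieDeriv f)^[n] id) (γ t) (X t)) fun n => by
    filter_upwards [hγ, hX] with t ht hXt
    have hg := contDiff_iterate_lieDeriv hf n
    simp only [Function.iterate_succ_apply']
    rw [fderiv_lieDeriv hf hg]
    have hd : DifferentiableAt ℝ (fderiv ℝ ((lieDeriv f)^[n] id)) (γ t) :=
      (contDiff_infty_iff_fderiv.1 hg).2.differentiable (by simp) _
    exact (hd.hasFDerivAt.comp_hasDerivAt t ht).clm_apply hXt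
  have hcoeff : ∀ j, fderiv ℝ (flowCoeff f j) (γ 0)
      = (j.factorial : ℝ)⁻¹ • fderiv ℝ ((lieDeriv f)^[j] id) (γ 0) := fun j =>
    (((contDiff_iterate_lieDeriv hf j).differentiable (by simp) (γ 0)).hasFDerivAt.const_smul
      ((j.factorial : ℝ)⁻¹)).fderiv
  simpa [hcoeff] using this

/-- Two solutions of the variational equation along the same flow line. -/
theorem exists_variational_solutions [CompleteSpace E] (hf : ContDiff ℝ ∞ f) (y v w : E) :
    ∃ γ X Y : ℝ → E, γ 0 = y ∧ X 0 = v ∧ Y 0 = w ∧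
      (∀ᶠ t in 𝓝 (0 : ℝ), HasDerivAt γ (f (γ t)) t) ∧
      (∀ᶠ t in 𝓝 (0 : ℝ), HasDerivAt X (fderiv ℝ f (γ t) (X t)) t) ∧
      ∀ᶠ t in 𝓝 (0 : ℝ), HasDerivAt Y (fderiv ℝ f (γ t) (Y t)) t := by
  have hf' := (contDiff_infty_iff_fderiv.1 hf).2
  have hg : ContDiff ℝ ∞ fun z : E × E × E =>
      (f z.1, fderiv ℝ f z.1 z.2.1, fderiv ℝ f z.1 z.2.2) := by
    refine (hf.comp contDiff_fst).prodMk (ContDiff.prodMk ?_ ?_)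
    · exact (hf'.comp contDiff_fst).clm_apply (contDiff_fst.comp contDiff_snd)
    · exact (hf'.comp contDiff_fst).clm_apply (contDiff_snd.comp contDiff_snd)
  obtain ⟨Z, h0, hZ⟩ := exists_isLocalSolution hg (y, v, w)
  refine ⟨fun t => (Z t).1, fun t => (Z t).2.1, fun t => (Z t).2.2, by simp [h0], by simp [h0],
    by simp [h0], ?_, ?_, ?_⟩ <;> filter_upwards [hZ] with t ht
  · exact hasFDerivAt_fst.comp_hasDerivAt t ht
  · exact (hasFDerivAt_fst.comp (Z t) hasFDerivAt_snd).comp_hasDerivAt t ht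
  · exact (hasFDerivAt_snd.comp (Z t) hasFDerivAt_snd).comp_hasDerivAt t ht

/-- If `f'(y)` is infinitesimally symplectic for the form `Ω` at every `y`, then `Ω` is constant
along pairs of solutions of the variational equation. -/
theorem eventually_form_eq_of_variational {γ X Y : ℝ → E} (Ω : E →L[ℝ] E →L[ℝ] ℝ)
    (hΩ : ∀ y v w : E, Ω (fderiv ℝ f y v) w + Ω v (fderiv ℝ f y w) = 0)
    (hX : ∀ᶠ t in 𝓝 (0 : ℝ), HasDerivAt X (fderiv ℝ f (γ t) (X t)) t)
    (hY : ∀ᶠ t in 𝓝 (0 : ℝ), HasDerivAt Y (fderiv ℝ f (γ t) (Y t)) t) :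
    ∀ᶠ t in 𝓝 (0 : ℝ), Ω (X t) (Y t) = Ω (X 0) (Y 0) := by
  obtain ⟨ε, hε, hball⟩ := Metric.eventually_nhds_iff_ball.1 (hX.and hY)
  have hd : ∀ t ∈ Metric.ball (0 : ℝ) ε, HasDerivAt (fun t => Ω (X t) (Y t)) 0 t := by
    intro t ht
    obtain ⟨h1, h2⟩ := hball t ht
    have := (Ω.hasFDerivAt.comp_hasDerivAt t h1).clm_apply h2
    rw [← hΩ (γ t) (X t) (Y t)]
    exact this
  filter_upwards [Metric.ball_mem_nhds (0 : ℝ) hε] with t ht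
  have := (convex_ball (0 : ℝ) ε).norm_image_sub_le_of_norm_hasDerivWithin_le
    (fun s hs => (hd s hs).hasDerivWithinAt) (C := 0) (by simp) (Metric.mem_ball_self hε) ht
  simpa [sub_eq_zero] using this

end Flow

/-! ### Inserting a truncated field into the expansion of the integrator -/

section Modified

variable {E : Type*} [NormedAddCommGroup E] [NormedSpace ℝ E]

theorem contDiff_truncatedField {F : ℕ → E → E} {M : ℕ} (hF : ∀ i < M, ContDiff ℝ ∞ (F i))
    (h : ℝ) : ContDiff ℝ ∞ (truncatedField F M h) :=
  ContDiff.sum fun i hi => contDiff_const.smul (hF i (Finset.mem_range.1 hi))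

theorem truncatedField_congr {F F' : ℕ → E → E} {M : ℕ} (hF : ∀ i < M, F i = F' i) :
    truncatedField F M = truncatedField F' M := by
  funext h z
  exact Finset.sum_congr rfl fun i hi => by rw [hF i (Finset.mem_range.1 hi)]

theorem iteratedFDeriv_truncatedField {F : ℕ → E → E} {M : ℕ}
    (hF : ∀ i < M, ContDiff ℝ ∞ (F i)) (h : ℝ) (k : ℕ) (y : E) :
    iteratedFDeriv ℝ k (truncatedField F M h) y
      = ∑ i ∈ Finset.range M, h ^ i • iteratedFDeriv ℝ k (F i) y := by
  have hk : ∀ i < M, ContDiff ℝ k (F i) := fun i hi =>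
    (hF i hi).of_le (by exact_mod_cast le_top)
  have h1 : truncatedField F M h = ∑ i ∈ Finset.range M, h ^ i • F i := by
    funext z
    simp [truncatedField, Finset.sum_apply]
  rw [h1, iteratedFDeriv_sum_apply (f := fun i => h ^ i • F i) fun i hi =>
    (contDiff_const.smul (hk i (Finset.mem_range.1 hi))).contDiffAt]
  exact Finset.sum_congr rfl fun i hi =>
    iteratedFDeriv_const_smul_apply (hk i (Finset.mem_range.1 hi)).contDiffAt

theorem contDiff_jet_truncatedField {F : ℕ → E → E} {M : ℕ} (hF : ∀ i < M, ContDiff ℝ ∞ (F i))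
    (m : ℕ) :
    ContDiff ℝ ∞ fun q : ℝ × E => (q.2, fun i : Fin (m + 1) =>
      iteratedFDeriv ℝ (i : ℕ) (truncatedField F M q.1) q.2) := by
  refine contDiff_snd.prodMk (contDiff_pi.2 fun k => ?_)
  simp only [iteratedFDeriv_truncatedField hF]
  refine ContDiff.sum fun i hi => (contDiff_fst.pow i).smul ?_
  have : ContDiff ℝ ∞ (iteratedFDeriv ℝ (k : ℕ) (F i)) :=
    (hF i (Finset.mem_range.1 hi)).iteratedFDeriv_right (by exact_mod_cast le_top)
  exact this.comp contDiff_snd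

theorem IsSmoothDiffOperator.contDiff_truncatedField {D : (E → E) → E → E}
    (hD : IsSmoothDiffOperator D) {F : ℕ → E → E} {M : ℕ} (hF : ∀ i < M, ContDiff ℝ ∞ (F i)) :
    ContDiff ℝ ∞ fun q : ℝ × E => D (truncatedField F M q.1) q.2 := by
  obtain ⟨m, G, hG, hDG⟩ := hD
  simp only [hDG _ (_root_.contDiff_truncatedField hF _)]
  exact hG.comp (contDiff_jet_truncatedField hF m)

/-- Adding the term `h ^ M F_M` to the field changes a smooth differential operator by
`O(h ^ M)`. -/
theorem IsSmoothDiffOperator.truncatedField_succ_sub_isBigO {D : (E → E) → E → E}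
    (hD : IsSmoothDiffOperator D) {F : ℕ → E → E} {M : ℕ} (hF : ∀ i < M + 1, ContDiff ℝ ∞ (F i))
    (y : E) :
    (fun h : ℝ => D (truncatedField F (M + 1) h) y - D (truncatedField F M h) y)
      =O[𝓝 0] fun h : ℝ => h ^ M := by
  have hF' : ∀ i < M, ContDiff ℝ ∞ (F i) := fun i hi => hF i (hi.trans M.lt_succ_self)
  -- For `M = 0` the two jets differ at `h = 0`, and only boundedness is claimed.
  rcases M.eq_zero_or_pos with rfl | hM
  · have h1 := (hD.contDiff_truncatedField hF).continuous.comp (Continuous.prodMk_left y)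
    have h2 := (hD.contDiff_truncatedField hF').continuous.comp (Continuous.prodMk_left y)
    simpa using (h1.sub h2).continuousAt.isBigO_one ℝ
  obtain ⟨m, G, hG, hDG⟩ := hD
  simp only [hDG _ (_root_.contDiff_truncatedField hF _),
    hDG _ (_root_.contDiff_truncatedField hF' _)]
  set x₁ : ℝ → E × ((i : Fin (m + 1)) → E [×(i : ℕ)]→L[ℝ] E) := fun h =>
    (y, fun i => iteratedFDeriv ℝ (i : ℕ) (truncatedField F (M + 1) h) y) with hx₁
  set x₂ : ℝ → E × ((i : Fin (m + 1)) → E [×(i : ℕ)]→L[ℝ] E) := fun h =>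
    (y, fun i => iteratedFDeriv ℝ (i : ℕ) (truncatedField F M h) y) with hx₂
  set z : E × ((i : Fin (m + 1)) → E [×(i : ℕ)]→L[ℝ] E) :=
    (0, fun i => iteratedFDeriv ℝ (i : ℕ) (F M) y) with hz
  have hsub : ∀ h, x₁ h - x₂ h = h ^ M • z := by
    intro h
    refine Prod.ext (by simp [hx₁, hx₂, hz]) (funext fun i => ?_)
    simp [hx₁, hx₂, hz, iteratedFDeriv_truncatedField hF, iteratedFDeriv_truncatedField hF',
      Finset.sum_range_succ]
  have c₁ : Tendsto x₁ (𝓝 0) (𝓝 (x₁ 0)) :=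
    ((contDiff_jet_truncatedField hF m).continuous.comp (Continuous.prodMk_left y)).tendsto 0
  have c₂ : Tendsto x₂ (𝓝 0) (𝓝 (x₂ 0)) :=
    ((contDiff_jet_truncatedField hF' m).continuous.comp (Continuous.prodMk_left y)).tendsto 0
  have h0 : x₂ 0 = x₁ 0 := by
    have := hsub 0
    rw [zero_pow hM.ne', zero_smul, sub_eq_zero] at this
    exact this.symm
  have hstrict := (hG.contDiffAt (x := x₁ 0)).hasStrictFDerivAt (by simp)
  refine IsBigO.trans (g := fun h => x₁ h - x₂ h)
    (hstrict.isBigO_sub.comp_tendsto (c₁.prodMk_nhds (h0 ▸ c₂))) ?_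
  simp only [hsub]
  exact isBigO_pow_smul (c := fun _ => z) continuousAt_const

namespace Integrator

variable (Φ : Integrator E)

/-- The coefficients of the expansion of the integrator, including `d₀(f, y) = y`. -/
def expansionCoeff (j : ℕ) (f : E → E) (y : E) : E :=
  match j with
  | 0 => y
  | j + 1 => Φ.coeff (j + 1) f y

/-- The polynomial `∑_{j < N} h ^ j d_j(f₁ + ⋯ + h ^ {M - 1} f_M, y)` as a function of `(h, y)`.
The number of terms is independent of the truncation of the field. -/
def modifiedSum (N : ℕ) (F : ℕ → E → E) (M : ℕ) (q : ℝ × E) : E :=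
  ∑ j ∈ Finset.range N, q.1 ^ j • Φ.expansionCoeff j (truncatedField F M q.1) q.2

theorem isSmoothDiffOperator_expansionCoeff (j : ℕ) :
    IsSmoothDiffOperator (Φ.expansionCoeff j) := by
  cases j with
  | zero => exact ⟨0, Prod.fst, contDiff_fst, fun _ _ _ => rfl⟩
  | succ j => exact Φ.coeff_diffOperator (j + 1) (by omega)

theorem add_sum_Icc_eq_sum_range (N : ℕ) (f : E → E) (y : E) (h : ℝ) :
    y + ∑ j ∈ Finset.Icc 1 N, h ^ j • Φ.coeff j f y
      = ∑ j ∈ Finset.range (N + 1), h ^ j • Φ.expansionCoeff j f y := by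
  rw [Finset.sum_range_succ', add_comm, Finset.range_eq_Ico,
    Finset.sum_Ico_add' (fun j => h ^ j • Φ.expansionCoeff j f y) 0 N 1]
  congr 1
  · refine Finset.sum_congr (by ext; simp) fun j hj => ?_
    obtain ⟨k, rfl⟩ := Nat.exists_eq_add_of_le' (Finset.mem_Ico.1 hj).1
    rfl
  · simp [expansionCoeff]

theorem expansionCoeff_expansion {f : E → E} (hf : ContDiff ℝ ∞ f) (y : E) (N : ℕ) :
    (fun h : ℝ => Φ.step h f y - ∑ j ∈ Finset.range (N + 1), h ^ j • Φ.expansionCoeff j f y)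
      =O[𝓝 0] fun h : ℝ => h ^ (N + 1) := by
  simpa only [← add_sum_Icc_eq_sum_range] using Φ.expansion f hf y N

/-- A consistent method has `d₁(f, y) = f(y)`. -/
theorem HasOrder.coeff_one [CompleteSpace E] {Φ : Integrator E} {p : ℕ} (hord : Φ.HasOrder p)
    (hp : 1 ≤ p) {f : E → E} (hf : ContDiff ℝ ∞ f) (y : E) : Φ.expansionCoeff 1 f y = f y := by
  obtain ⟨γ, hγ⟩ := exists_isLocalSolution hf y
  have h1 := (hord f hf y γ hγ).trans (isBigO_pow_of_le (show 2 ≤ p + 1 by omega))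
  have h2 := (h1.sub (Φ.expansionCoeff_expansion hf y 1)).add (flowCoeff_expansion hf hγ 2)
  have h3 := eq_zero_of_sum_pow_smul_isBigO (N := 2)
    (a := fun j => Φ.expansionCoeff j f y - flowCoeff f j y)
    (h2.congr_left fun h => by simp only [smul_sub, Finset.sum_sub_distrib]; abel) 1 (by omega)
  rw [sub_eq_zero.1 h3]
  simp [flowCoeff, lieDeriv]

theorem contDiff_modifiedSum (N : ℕ) {F : ℕ → E → E} {M : ℕ}
    (hF : ∀ i < M, ContDiff ℝ ∞ (F i)) : ContDiff ℝ ∞ (Φ.modifiedSum N F M) :=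
  ContDiff.sum fun j _ => (contDiff_fst.pow j).smul
    ((Φ.isSmoothDiffOperator_expansionCoeff j).contDiff_truncatedField hF)

/-- Including the next field `h ^ M f_{M+1}` adds `h ^ (M + 1) f_{M+1}(y)` to the modified sum, up
to higher order: only `d₁` contributes, and `d₁(f, y) = f(y)`. -/
theorem modifiedSum_succ_sub_isBigO
    (h₁ : ∀ f : E → E, ContDiff ℝ ∞ f → ∀ y, Φ.expansionCoeff 1 f y = f y)
    {F : ℕ → E → E} {M : ℕ} (hF : ∀ i < M + 1, ContDiff ℝ ∞ (F i)) (y : E) :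
    (fun h : ℝ => Φ.modifiedSum (M + 2) F (M + 1) (h, y) - Φ.modifiedSum (M + 2) F M (h, y)
      - h ^ (M + 1) • F M y) =O[𝓝 0] fun h : ℝ => h ^ (M + 2) := by
  have hF' : ∀ i < M, ContDiff ℝ ∞ (F i) := fun i hi => hF i (hi.trans M.lt_succ_self)
  have hsum : ∀ h : ℝ, Φ.modifiedSum (M + 2) F (M + 1) (h, y) - Φ.modifiedSum (M + 2) F M (h, y)
      - h ^ (M + 1) • F M y = ∑ j ∈ Finset.range M, h ^ (j + 2) •
        (Φ.expansionCoeff (j + 2) (truncatedField F (M + 1) h) y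
          - Φ.expansionCoeff (j + 2) (truncatedField F M h) y) := by
    intro h
    simp only [modifiedSum, Finset.sum_range_succ' _ (M + 1), Finset.sum_range_succ' _ M, zero_add,
      h₁ _ (contDiff_truncatedField hF h), h₁ _ (contDiff_truncatedField hF' h), smul_sub,
      Finset.sum_sub_distrib, pow_zero, pow_one, one_smul]
    have ht : truncatedField F (M + 1) h y = truncatedField F M h y + h ^ M • F M y := by
      simp [truncatedField, Finset.sum_range_succ]
    rw [ht, pow_succ', mul_smul, smul_add]
    simp only [expansionCoeff, add_assoc, Nat.reduceAdd]
    abel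
  simp_rw [hsum]
  refine IsBigO.fun_sum fun j _ => ?_
  have hj := ((Φ.isSmoothDiffOperator_expansionCoeff (j + 2)).truncatedField_succ_sub_isBigO hF y)
  have := (isBigO_pow_of_le (show 2 ≤ j + 2 by omega)).smul hj
  refine this.congr_right fun h => ?_
  simp [← pow_add, add_comm]

/-- The field `f_{M+1}` of the inverse modified equation, computed from `f₁, …, f_M`. -/
noncomputable def nextField (f : E → E) (F : ℕ → E → E) (M : ℕ) (y : E) : E :=
  flowCoeff f (M + 1) y - taylorCoeff (M + 1) (Φ.modifiedSum (M + 2) F M) y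

theorem nextField_congr (f : E → E) {F F' : ℕ → E → E} {M : ℕ} (hF : ∀ i < M, F i = F' i) :
    Φ.nextField f F M = Φ.nextField f F' M := by
  funext y
  have : Φ.modifiedSum (M + 2) F M = Φ.modifiedSum (M + 2) F' M := by
    funext q
    simp only [modifiedSum, truncatedField_congr hF]
  rw [nextField, nextField, this]

theorem contDiff_nextField {f : E → E} (hf : ContDiff ℝ ∞ f) {F : ℕ → E → E} {M : ℕ}
    (hF : ∀ i < M, ContDiff ℝ ∞ (F i)) : ContDiff ℝ ∞ (Φ.nextField f F M) :=
  (contDiff_flowCoeff hf _).sub (contDiff_taylorCoeff (Φ.contDiff_modifiedSum _ hF) _)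

/-- If `f₁, …, f_M` match the flow up to order `M`, then the coefficients of the modified sum and
of the flow agree up to that order. -/
theorem taylorCoeff_modifiedSum_eq_flowCoeff {f : E → E} (hf : ContDiff ℝ ∞ f) {F : ℕ → E → E}
    {M : ℕ} (hF : ∀ i < M, ContDiff ℝ ∞ (F i)) {y : E} {γ : ℝ → E} (hγ : IsLocalSolution f y γ)
    (hM : (fun h : ℝ => Φ.modifiedSum (M + 1) F M (h, y) - γ h) =O[𝓝 0] fun h : ℝ => h ^ (M + 1)) :
    ∀ j < M + 1, taylorCoeff j (Φ.modifiedSum (M + 2) F M) y = flowCoeff f j y := by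
  have h1 := taylorCoeff_expansion isOpen_univ (Φ.contDiff_modifiedSum (M + 2) hF).contDiffOn
    (Set.mem_univ ((0 : ℝ), y)) (M + 1)
  have h2 : (fun h : ℝ => h ^ (M + 1) • Φ.expansionCoeff (M + 1) (truncatedField F M h) y)
      =O[𝓝 0] fun h : ℝ => h ^ (M + 1) :=
    isBigO_pow_smul (((Φ.isSmoothDiffOperator_expansionCoeff (M + 1)).contDiff_truncatedField
      hF).continuous.comp (Continuous.prodMk_left y)).continuousAt
  have h3 := ((hM.add h2).sub h1).add (flowCoeff_expansion hf hγ (M + 1))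
  intro j hj
  refine sub_eq_zero.1 (eq_zero_of_sum_pow_smul_isBigO
    (a := fun j => taylorCoeff j (Φ.modifiedSum (M + 2) F M) y - flowCoeff f j y)
    (h3.congr_left fun h => ?_) j hj)
  simp only [modifiedSum, smul_sub, Finset.sum_sub_distrib, Finset.sum_range_succ _ (M + 1)]
  abel

/-- The step of the recursion: if the powers up to `h ^ M` match, then those up to `h ^ (M + 1)`
match exactly when `f_{M+1}` has the value prescribed by `nextField`. -/
theorem matching_succ_iff
    (h₁ : ∀ f : E → E, ContDiff ℝ ∞ f → ∀ y, Φ.expansionCoeff 1 f y = f y)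
    {f : E → E} (hf : ContDiff ℝ ∞ f) {F : ℕ → E → E} {M : ℕ}
    (hF : ∀ i < M + 1, ContDiff ℝ ∞ (F i)) {y : E} {γ : ℝ → E} (hγ : IsLocalSolution f y γ)
    (hM : (fun h : ℝ => Φ.modifiedSum (M + 1) F M (h, y) - γ h) =O[𝓝 0] fun h : ℝ => h ^ (M + 1)) :
    ((fun h : ℝ => Φ.modifiedSum (M + 2) F (M + 1) (h, y) - γ h) =O[𝓝 0] fun h : ℝ => h ^ (M + 2))
      ↔ F M y = Φ.nextField f F M y := by
  have hF' : ∀ i < M, ContDiff ℝ ∞ (F i) := fun i hi => hF i (hi.trans M.lt_succ_self)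
  have heq := Φ.taylorCoeff_modifiedSum_eq_flowCoeff hf hF' hγ hM
  have h1 := taylorCoeff_expansion isOpen_univ (Φ.contDiff_modifiedSum (M + 2) hF').contDiffOn
    (Set.mem_univ ((0 : ℝ), y)) (M + 2)
  have h2 : (fun h : ℝ => Φ.modifiedSum (M + 2) F (M + 1) (h, y) - γ h
      - h ^ (M + 1) • (F M y - Φ.nextField f F M y)) =O[𝓝 0] fun h : ℝ => h ^ (M + 2) := by
    refine (((Φ.modifiedSum_succ_sub_isBigO h₁ hF y).add h1).sub
      (flowCoeff_expansion hf hγ (M + 2))).congr_left fun h => ?_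
    rw [Finset.sum_range_succ _ (M + 1), Finset.sum_range_succ _ (M + 1),
      Finset.sum_congr rfl fun j hj => by rw [heq j (Finset.mem_range.1 hj)], nextField]
    simp only [smul_sub]
    abel
  constructor
  · intro h
    refine sub_eq_zero.1 (eq_zero_of_pow_smul_isLittleO (n := M + 1) (IsBigO.trans_isLittleO ?_
      (isLittleO_pow_pow (𝕜 := ℝ) (M + 1).lt_succ_self)))
    exact (h.sub h2).congr_left fun h => by abel
  · intro h
    simpa [h] using h2

/-- The inverse modified equation: each field is determined by its predecessors. The zero fields
passed to `nextField` from index `M` on do not affect its value. -/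
noncomputable def inverseModified (f : E → E) (M : ℕ) : E → E :=
  Φ.nextField f (fun i => if i < M then inverseModified f i else 0) M
termination_by M

theorem inverseModified_eq (f : E → E) (M : ℕ) :
    Φ.inverseModified f M = Φ.nextField f (Φ.inverseModified f) M := by
  rw [inverseModified]
  exact Φ.nextField_congr f fun i hi => by simp [hi]

theorem contDiff_inverseModified {f : E → E} (hf : ContDiff ℝ ∞ f) (M : ℕ) :
    ContDiff ℝ ∞ (Φ.inverseModified f M) := by
  induction M using Nat.strong_induction_on with
  | _ M ih =>
    rw [inverseModified_eq]
    exact Φ.contDiff_nextField hf ih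

theorem matching_zero {f : E → E} (hf : ContDiff ℝ ∞ f) (F : ℕ → E → E) {y : E} {γ : ℝ → E}
    (hγ : IsLocalSolution f y γ) :
    (fun h : ℝ => Φ.modifiedSum (0 + 1) F 0 (h, y) - γ h) =O[𝓝 0] fun h : ℝ => h ^ (0 + 1) := by
  refine (flowCoeff_expansion hf hγ (0 + 1)).neg_left.congr_left fun h => ?_
  simp [modifiedSum, expansionCoeff, flowCoeff]

theorem isInverseModified_iff_modifiedSum {f : E → E} {F : ℕ → E → E} :
    Φ.IsInverseModified f F ↔ (∀ i, ContDiff ℝ ∞ (F i)) ∧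
      ∀ (N : ℕ) (y : E) (γ : ℝ → E), IsLocalSolution f y γ →
        (fun h : ℝ => Φ.modifiedSum (N + 1) F N (h, y) - γ h) =O[𝓝 0] fun h : ℝ => h ^ (N + 1) := by
  simp only [modifiedSum, ← add_sum_Icc_eq_sum_range]
  exact ⟨fun h => ⟨h.smooth, h.matching⟩, fun h => ⟨h.1, h.2⟩⟩

theorem isInverseModified_inverseModified
    (h₁ : ∀ f : E → E, ContDiff ℝ ∞ f → ∀ y, Φ.expansionCoeff 1 f y = f y)
    {f : E → E} (hf : ContDiff ℝ ∞ f) : Φ.IsInverseModified f (Φ.inverseModified f) := by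
  have hs := Φ.contDiff_inverseModified hf
  refine Φ.isInverseModified_iff_modifiedSum.2 ⟨hs, fun N y γ hγ => ?_⟩
  induction N with
  | zero => exact Φ.matching_zero hf _ hγ
  | succ N ih =>
    exact (Φ.matching_succ_iff h₁ hf (fun i _ => hs i) hγ ih).2
      (congrFun (Φ.inverseModified_eq f N) y)

theorem IsInverseModified.eq_nextField [CompleteSpace E] {Φ : Integrator E}
    (h₁ : ∀ f : E → E, ContDiff ℝ ∞ f → ∀ y, Φ.expansionCoeff 1 f y = f y)
    {f : E → E} (hf : ContDiff ℝ ∞ f) {F : ℕ → E → E} (hF : Φ.IsInverseModified f F) (M : ℕ) :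
    F M = Φ.nextField f F M := by
  obtain ⟨hs, hm⟩ := Φ.isInverseModified_iff_modifiedSum.1 hF
  funext y
  obtain ⟨γ, hγ⟩ := exists_isLocalSolution hf y
  exact (Φ.matching_succ_iff h₁ hf (fun i _ => hs i) hγ (hm M y γ hγ)).1 (hm (M + 1) y γ hγ)

theorem IsInverseModified.eq_inverseModified [CompleteSpace E] {Φ : Integrator E}
    (h₁ : ∀ f : E → E, ContDiff ℝ ∞ f → ∀ y, Φ.expansionCoeff 1 f y = f y)
    {f : E → E} (hf : ContDiff ℝ ∞ f) {F : ℕ → E → E} (hF : Φ.IsInverseModified f F) :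
    F = Φ.inverseModified f := by
  funext M
  induction M using Nat.strong_induction_on with
  | _ M ih => rw [hF.eq_nextField h₁ hf, inverseModified_eq, Φ.nextField_congr f ih]

end Integrator

end Modified

/-! ### Preservation of a bilinear form, order by order -/

section Form

variable {E : Type*} [NormedAddCommGroup E] [NormedSpace ℝ E]

theorem form_isBigO (Ω : E →L[ℝ] E →L[ℝ] ℝ) {V W : ℝ → E} {a b : ℝ → ℝ}
    (hV : V =O[𝓝 0] a) (hW : W =O[𝓝 0] b) :
    (fun h => Ω (V h) (W h)) =O[𝓝 0] fun h => a h * b h := by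
  refine IsBigO.trans (IsBigO.of_bound ‖Ω‖ (Eventually.of_forall fun h => ?_))
    (hV.norm_left.mul hW.norm_left)
  rw [norm_mul, norm_norm, norm_norm, ← mul_assoc]
  exact Ω.le_opNorm₂ _ _

theorem form_sub_isBigO (Ω : E →L[ℝ] E →L[ℝ] ℝ) {V W V' W' : ℝ → E} {n : ℕ}
    (hV : (fun h => V h - V' h) =O[𝓝 0] fun h : ℝ => h ^ n)
    (hW : (fun h => W h - W' h) =O[𝓝 0] fun h : ℝ => h ^ n)
    (hV' : ContinuousAt V' 0) (hWc : ContinuousAt W 0) :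
    (fun h => Ω (V h) (W h) - Ω (V' h) (W' h)) =O[𝓝 0] fun h : ℝ => h ^ n := by
  have h1 := form_isBigO Ω hV (hWc.isBigO_one ℝ)
  have h2 := form_isBigO Ω (hV'.isBigO_one ℝ) hW
  simp only [mul_one, one_mul] at h1 h2
  refine (h1.add h2).congr_left fun h => ?_
  simp

/-- The coefficient of `h ^ n` in `Ω (∑ h ^ i a_i) (∑ h ^ j b_j)`. -/
noncomputable def formCoeff (Ω : E →L[ℝ] E →L[ℝ] ℝ) (a b : ℕ → E) (n : ℕ) : ℝ :=
  ∑ k ∈ Finset.HasAntidiagonal.antidiagonal n, Ω (a k.1) (b k.2)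

theorem form_sum_pow_isBigO (Ω : E →L[ℝ] E →L[ℝ] ℝ) (N : ℕ) {a b : ℕ → ℝ → E}
    (ha : ∀ i, ContinuousAt (a i) 0) (hb : ∀ i, ContinuousAt (b i) 0) :
    (fun h : ℝ => Ω (∑ i ∈ Finset.range N, h ^ i • a i h) (∑ j ∈ Finset.range N, h ^ j • b j h)
      - ∑ n ∈ Finset.range N, h ^ n * formCoeff Ω (fun i => a i h) (fun j => b j h) n)
      =O[𝓝 0] fun h : ℝ => h ^ N := by
  refine (sum_sum_pow_mul_isBigO N (x := fun i j h => Ω (a i h) (b j h)) fun i j =>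
    (Ω.continuous.continuousAt.comp (ha i)).clm_apply (hb j)).congr_left fun h => ?_
  simp only [map_sum, map_smul, sum_apply, smul_apply,
    smul_eq_mul, formCoeff, pow_add, mul_assoc]
  rw [Finset.sum_comm]
  refine congrArg₂ _ (Finset.sum_congr rfl fun i _ => ?_) rfl
  rw [Finset.mul_sum]
  exact Finset.sum_congr rfl fun j _ => by ring

namespace Integrator

variable (Φ : Integrator E)

theorem taylorCoeff_step {f : E → E} (hf : ContDiff ℝ ∞ f) (n : ℕ) :
    taylorCoeff n (fun q : ℝ × E => Φ.step q.1 f q.2) = Φ.expansionCoeff n f := by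
  funext y
  have h1 := taylorCoeff_expansion (Φ.isOpen_dom f hf) (Φ.contDiffOn_step f hf)
    (Φ.zero_mem_dom f hf y) (n + 1)
  have h2 := (Φ.expansionCoeff_expansion hf y n).sub h1
  refine (sub_eq_zero.1 (eq_zero_of_sum_pow_smul_isBigO (N := n + 1)
    (a := fun j => taylorCoeff j (fun q : ℝ × E => Φ.step q.1 f q.2) y - Φ.expansionCoeff j f y)
    (h2.congr_left fun h => ?_) n n.lt_succ_self))
  simp only [smul_sub, Finset.sum_sub_distrib]
  abel

/-- If the one-step map preserves the form `Ω`, then its expansion preserves `Ω` in every power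
of `h`. -/
theorem formCoeff_fderiv_expansionCoeff (Ω : E →L[ℝ] E →L[ℝ] ℝ) {f : E → E}
    (hf : ContDiff ℝ ∞ f)
    (hΩ : ∀ h y, (h, y) ∈ Φ.dom f → ∀ v w,
      Ω (fderiv ℝ (Φ.step h f) y v) (fderiv ℝ (Φ.step h f) y w) = Ω v w)
    (y v w : E) (n : ℕ) :
    formCoeff Ω (fun i => fderiv ℝ (Φ.expansionCoeff i f) y v)
      (fun j => fderiv ℝ (Φ.expansionCoeff j f) y w) n = if n = 0 then Ω v w else 0 := by
  set u : ℝ × E → E := fun q => Φ.step q.1 f q.2 with hu_def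
  have hU := Φ.isOpen_dom f hf
  have hu : ContDiffOn ℝ ∞ u (Φ.dom f) := Φ.contDiffOn_step f hf
  have hy := Φ.zero_mem_dom f hf y
  have hU' : ∀ᶠ t in 𝓝 (0 : ℝ), (t, y) ∈ Φ.dom f :=
    (Continuous.prodMk_left y).continuousAt.preimage_mem_nhds (hU.mem_nhds hy)
  have hexp : ∀ v, (fun h : ℝ => dirDeriv (0, v) u (h, y)
      - ∑ j ∈ Finset.range (n + 1), h ^ j • fderiv ℝ (Φ.expansionCoeff j f) y v)
      =O[𝓝 0] fun h : ℝ => h ^ (n + 1) := by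
    intro v
    simp only [← Φ.taylorCoeff_step hf, ← hu_def, fderiv_taylorCoeff hU hu hy]
    exact taylorCoeff_expansion hU (contDiffOn_dirDeriv hU hu (0, v)) hy (n + 1)
  have hcont : ContinuousAt (fun h : ℝ => dirDeriv (0, w) u (h, y)) 0 :=
    ((contDiffOn_dirDeriv hU hu (0, w)).continuousOn.continuousAt (hU.mem_nhds hy)).comp
      (f := fun h : ℝ => (h, y)) (Continuous.prodMk_left y).continuousAt
  have hpoly : ∀ v, ContinuousAt (fun h : ℝ => ∑ j ∈ Finset.range (n + 1),
      h ^ j • fderiv ℝ (Φ.expansionCoeff j f) y v) 0 := fun v => by fun_prop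
  have h1 := (form_sub_isBigO Ω (hexp v) (hexp w) (hpoly v) hcont).add
    (form_sum_pow_isBigO Ω (n + 1) (a := fun i _ => fderiv ℝ (Φ.expansionCoeff i f) y v)
      (b := fun i _ => fderiv ℝ (Φ.expansionCoeff i f) y w)
      (fun _ => continuousAt_const) fun _ => continuousAt_const)
  have h2 : (fun h : ℝ => ∑ m ∈ Finset.range (n + 1), h ^ m •
      ((if m = 0 then Ω v w else 0) - formCoeff Ω (fun i => fderiv ℝ (Φ.expansionCoeff i f) y v)
      (fun j => fderiv ℝ (Φ.expansionCoeff j f) y w) m)) =O[𝓝 0] fun h : ℝ => h ^ (n + 1) := by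
    refine h1.congr' ?_ EventuallyEq.rfl
    filter_upwards [hU'] with h hh
    have hd : DifferentiableAt ℝ u (h, y) :=
      (hu.contDiffAt (hU.mem_nhds hh)).differentiableAt (by simp)
    have hs : Ω (dirDeriv (0, v) u (h, y)) (dirDeriv (0, w) u (h, y)) = Ω v w := by
      rw [← fderiv_slice hd, ← fderiv_slice hd]
      exact hΩ h y hh v w
    simp only [hs, sub_add_sub_cancel, smul_eq_mul, mul_sub, Finset.sum_sub_distrib]
    simp
  exact (sub_eq_zero.1 (eq_zero_of_sum_pow_smul_isBigO h2 n n.lt_succ_self)).symm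

/-- If the one-step map preserves `Ω` for each of the fields `f₁ + ⋯ + h ^ {M - 1} f_M`, then the
modified sum preserves `Ω` up to the order of its truncation. The parameter of the field is frozen
first, since the domain of the one-step map may vary with the field; only afterwards is it set
equal to the step size. -/
theorem form_dirDeriv_modifiedSum_isBigO (Ω : E →L[ℝ] E →L[ℝ] ℝ) (N : ℕ) {F : ℕ → E → E} {M : ℕ}
    (hF : ∀ i < M, ContDiff ℝ ∞ (F i))
    (hΩ : ∀ s h y, (h, y) ∈ Φ.dom (truncatedField F M s) → ∀ v w,
      Ω (fderiv ℝ (Φ.step h (truncatedField F M s)) y v)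
        (fderiv ℝ (Φ.step h (truncatedField F M s)) y w) = Ω v w) (y v w : E) :
    (fun h : ℝ => Ω v w - Ω (dirDeriv (0, v) (Φ.modifiedSum (N + 1) F M) (h, y))
      (dirDeriv (0, w) (Φ.modifiedSum (N + 1) F M) (h, y))) =O[𝓝 0] fun h : ℝ => h ^ (N + 1) := by
  have hD : ∀ j, ContDiff ℝ ∞ fun q : ℝ × E =>
      Φ.expansionCoeff j (truncatedField F M q.1) q.2 := fun j =>
    (Φ.isSmoothDiffOperator_expansionCoeff j).contDiff_truncatedField hF
  have hslice : ∀ j (v : E) (h : ℝ), fderiv ℝ (Φ.expansionCoeff j (truncatedField F M h)) y v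
      = dirDeriv (0, v) (fun q : ℝ × E => Φ.expansionCoeff j (truncatedField F M q.1) q.2)
        (h, y) := fun j v h =>
    fderiv_slice (u := fun q : ℝ × E => Φ.expansionCoeff j (truncatedField F M q.1) q.2)
      ((hD j).differentiable (by simp) (h, y)) v
  have hcont : ∀ j (v : E), ContinuousAt (fun h : ℝ =>
      fderiv ℝ (Φ.expansionCoeff j (truncatedField F M h)) y v) 0 := by
    intro j v
    simp only [hslice]
    have := contDiffOn_univ.1 (contDiffOn_dirDeriv isOpen_univ (hD j).contDiffOn (0, v))
    exact (this.continuous.comp (Continuous.prodMk_left y)).continuousAt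
  have hsum : ∀ (v : E) (h : ℝ), dirDeriv (0, v) (Φ.modifiedSum (N + 1) F M) (h, y)
      = ∑ j ∈ Finset.range (N + 1),
        h ^ j • fderiv ℝ (Φ.expansionCoeff j (truncatedField F M h)) y v := by
    intro v h
    rw [← fderiv_slice ((Φ.contDiff_modifiedSum (N + 1) hF).differentiable (by simp) (h, y))]
    have hj : ∀ j, HasFDerivAt (Φ.expansionCoeff j (truncatedField F M h))
        (fderiv ℝ (Φ.expansionCoeff j (truncatedField F M h)) y) y := fun j =>
      (hasFDerivAt_slice ((hD j).differentiable (by simp) (h, y))).differentiableAt.hasFDerivAt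
    have := HasFDerivAt.fun_sum (u := Finset.range (N + 1)) fun j _ => (hj j).const_smul (h ^ j)
    rw [show fderiv ℝ (fun z => Φ.modifiedSum (N + 1) F M (h, z)) y = _ from this.fderiv]
    simp
  simp only [hsum]
  refine (form_sum_pow_isBigO Ω (N + 1) (hcont · v) (hcont · w)).neg_left.congr_left fun h => ?_
  simp only [Φ.formCoeff_fderiv_expansionCoeff Ω (contDiff_truncatedField hF h) (hΩ h)]
  simp

/-- If `f'` is infinitesimally symplectic for `Ω`, the integrator preserves `Ω`
for the fields `f₁ + ⋯ + h ^ {M - 1} f_M`, and these match the flow up to order `M`, then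
the derivative of the next field is infinitesimally symplectic as well. The modified sum and the
flow both preserve `Ω`, and their derivatives agree up to `-h ^ (M + 1) f_{M+1}'`. -/
theorem form_fderiv_nextField [CompleteSpace E] (Ω : E →L[ℝ] E →L[ℝ] ℝ) {f : E → E}
    (hf : ContDiff ℝ ∞ f)
    (hfΩ : ∀ y v w : E, Ω (fderiv ℝ f y v) w + Ω v (fderiv ℝ f y w) = 0)
    {F : ℕ → E → E} {M : ℕ} (hF : ∀ i < M, ContDiff ℝ ∞ (F i))
    (hΩ : ∀ s h y, (h, y) ∈ Φ.dom (truncatedField F M s) → ∀ v w,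
      Ω (fderiv ℝ (Φ.step h (truncatedField F M s)) y v)
        (fderiv ℝ (Φ.step h (truncatedField F M s)) y w) = Ω v w)
    (hM : ∀ y γ, IsLocalSolution f y γ →
      (fun h : ℝ => Φ.modifiedSum (M + 1) F M (h, y) - γ h) =O[𝓝 0] fun h : ℝ => h ^ (M + 1))
    (y v w : E) :
    Ω (fderiv ℝ (Φ.nextField f F M) y v) w + Ω v (fderiv ℝ (Φ.nextField f F M) y w) = 0 := by
  -- The derivative of the flow in the directions `v` and `w` is given by the curves `X` and `Y`.
  obtain ⟨γ, X, Y, rfl, rfl, rfl, hγ, hX, hY⟩ := exists_variational_solutions hf y v w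
  set u := Φ.modifiedSum (M + 2) F M with hu_def
  set g := Φ.nextField f F M
  have hu : ContDiff ℝ ∞ u := Φ.contDiff_modifiedSum (M + 2) hF
  have heq : ∀ j < M + 1, taylorCoeff j u = flowCoeff f j := by
    intro j hj
    funext z
    obtain ⟨γ', hγ'⟩ := exists_isLocalSolution hf z
    exact Φ.taylorCoeff_modifiedSum_eq_flowCoeff hf hF hγ' (hM z γ' hγ') j hj
  have hg : ∀ v, fderiv ℝ g (γ 0) v = fderiv ℝ (flowCoeff f (M + 1)) (γ 0) v
      - fderiv ℝ (taylorCoeff (M + 1) u) (γ 0) v := by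
    intro v
    have := ((contDiff_flowCoeff hf (M + 1)).differentiable (by simp) (γ 0)).hasFDerivAt.sub
      ((contDiff_taylorCoeff hu (M + 1)).differentiable (by simp) (γ 0)).hasFDerivAt
    rw [show fderiv ℝ g (γ 0) = _ from this.fderiv]
    rfl
  have hdiff : ∀ X : ℝ → E, (∀ᶠ t in 𝓝 (0 : ℝ), HasDerivAt X (fderiv ℝ f (γ t) (X t)) t) →
      (fun h : ℝ => dirDeriv (0, X 0) u (h, γ 0)
        - (X h - h ^ (M + 1) • fderiv ℝ g (γ 0) (X 0))) =O[𝓝 0] fun h : ℝ => h ^ (M + 2) := by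
    intro X hX
    have h1 := taylorCoeff_expansion isOpen_univ
      (contDiffOn_dirDeriv isOpen_univ hu.contDiffOn (0, X 0))
      (Set.mem_univ ((0 : ℝ), γ 0)) (M + 2)
    simp only [← fderiv_taylorCoeff isOpen_univ hu.contDiffOn (Set.mem_univ ((0 : ℝ), γ 0))] at h1
    refine (h1.sub (fderiv_flowCoeff_expansion hf hγ hX (M + 2))).congr_left fun h => ?_
    rw [Finset.sum_range_succ _ (M + 1), Finset.sum_range_succ _ (M + 1),
      Finset.sum_congr rfl fun j hj => by rw [heq j (Finset.mem_range.1 hj)], hg, smul_sub]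
    abel
  have hYc : ContinuousAt (fun h : ℝ => dirDeriv (0, Y 0) u (h, γ 0)) 0 :=
    ((contDiffOn_univ.1 (contDiffOn_dirDeriv isOpen_univ hu.contDiffOn (0, Y 0))).continuous.comp
      (Continuous.prodMk_left (γ 0))).continuousAt
  set A := fderiv ℝ g (γ 0) (X 0)
  set B := fderiv ℝ g (γ 0) (Y 0)
  have hXc : ContinuousAt X 0 := hX.self_of_nhds.continuousAt
  have hYc' : ContinuousAt Y 0 := hY.self_of_nhds.continuousAt
  have h1 := (form_sub_isBigO Ω (hdiff X hX) (hdiff Y hY) (by fun_prop) hYc).add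
    (Φ.form_dirDeriv_modifiedSum_isBigO Ω (M + 1) hF hΩ (γ 0) (X 0) (Y 0))
  -- Divided by `h ^ (M + 1)`, the defect of the forms is a continuous function of `h`.
  set c : ℝ → ℝ := fun h => Ω A (Y h) + Ω (X h) B - h ^ (M + 1) * Ω A B with hc_def
  have hc : ContinuousAt c 0 := by fun_prop
  have hc0 : c 0 = Ω A (Y 0) + Ω (X 0) B := by simp [hc_def]
  have h2 : (fun h : ℝ => h ^ (M + 1) • c h) =O[𝓝 0] fun h : ℝ => h ^ (M + 2) := by
    refine h1.congr' ?_ EventuallyEq.rfl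
    filter_upwards [eventually_form_eq_of_variational Ω hfΩ hX hY] with h hh
    simp only [← hu_def, map_sub, map_smul, sub_apply, smul_apply, smul_eq_mul, hc_def, hh]
    ring
  have h3 : (fun h : ℝ => h ^ (M + 1) • (c h - c 0)) =o[𝓝 0] fun h : ℝ => h ^ (M + 1) := by
    have := (isLittleO_one_iff ℝ).2 (tendsto_sub_nhds_zero_iff.2 hc.tendsto)
    simpa using (isBigO_refl (fun h : ℝ => h ^ (M + 1)) (𝓝 0)).smul_isLittleO this
  rw [← hc0]
  refine eq_zero_of_pow_smul_isLittleO (n := M + 1)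
    (((h2.trans_isLittleO (isLittleO_pow_pow (𝕜 := ℝ) (M + 1).lt_succ_self)).sub h3).congr_left
      fun h => ?_)
  simp only [smul_sub]
  abel

end Integrator

end Form

/-! ### The symplectic form and Hamiltonian vector fields -/

section Hamiltonian

variable {d : ℕ}

theorem structureMatrix_transpose : (structureMatrix d)ᵀ = -structureMatrix d := by
  simp [structureMatrix, Matrix.fromBlocks_transpose, Matrix.fromBlocks_neg]

theorem structureMatrix_mul_self : structureMatrix d * structureMatrix d = -1 := by
  rw [structureMatrix, Matrix.fromBlocks_multiply, ← Matrix.fromBlocks_one, Matrix.fromBlocks_neg]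
  simp

theorem structureMatrix_inv : (structureMatrix d)⁻¹ = -structureMatrix d :=
  Matrix.inv_eq_right_inv (by rw [mul_neg, structureMatrix_mul_self, neg_neg])

/-- The symplectic form `vᵀ J w` on the phase space. -/
noncomputable def symplecticForm (d : ℕ) : PhaseSpace d →L[ℝ] PhaseSpace d →L[ℝ] ℝ :=
  LinearMap.toContinuousBilinearMap
    ((innerₗ (PhaseSpace d)).compl₂ (Matrix.toEuclideanLin (structureMatrix d)))

theorem symplecticForm_apply (v w : PhaseSpace d) :
    symplecticForm d v w = inner ℝ v (Matrix.toEuclideanLin (structureMatrix d) w) := rfl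

theorem symplecticForm_eq_dotProduct (v w : PhaseSpace d) :
    symplecticForm d v w = v.ofLp ⬝ᵥ (structureMatrix d *ᵥ w.ofLp) := by
  rw [symplecticForm_apply, EuclideanSpace.inner_eq_star_dotProduct, dotProduct_comm]
  simp [Matrix.toLpLin_apply]

theorem symplecticForm_swap (v w : PhaseSpace d) :
    symplecticForm d v w = -symplecticForm d w v := by
  rw [symplecticForm_eq_dotProduct, symplecticForm_eq_dotProduct, Matrix.dotProduct_mulVec,
    ← Matrix.mulVec_transpose, structureMatrix_transpose, dotProduct_comm, Matrix.neg_mulVec,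
    dotProduct_neg]

theorem toEuclideanLin_structureMatrix_inv_apply (z : PhaseSpace d) :
    Matrix.toEuclideanLin (structureMatrix d)⁻¹
      (Matrix.toEuclideanLin (structureMatrix d) z) = z := by
  apply WithLp.ofLp_injective
  simp [Matrix.toLpLin_apply, Matrix.mulVec_mulVec, Matrix.neg_mulVec,
    structureMatrix_inv, structureMatrix_mul_self]

theorem toEuclideanLin_structureMatrix_apply_inv (z : PhaseSpace d) :
    Matrix.toEuclideanLin (structureMatrix d)
      (Matrix.toEuclideanLin (structureMatrix d)⁻¹ z) = z := by
  apply WithLp.ofLp_injective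
  simp [Matrix.toLpLin_apply, Matrix.mulVec_mulVec, Matrix.neg_mulVec, Matrix.mulVec_neg,
    structureMatrix_inv, structureMatrix_mul_self]

/-- The vector `J⁻¹ ∇H(y)` represents the differential of `H` with respect to the symplectic
form. -/
theorem hamiltonianField_apply_eq_iff {H : PhaseSpace d → ℝ} {y z : PhaseSpace d} :
    hamiltonianField H y = z ↔ ∀ v, symplecticForm d v z = fderiv ℝ H y v := by
  have hgrad : ∀ v, inner ℝ v (∇ H y) = fderiv ℝ H y v := fun v => by
    rw [real_inner_comm, gradient, InnerProductSpace.toDual_symm_apply]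
  simp only [hamiltonianField, symplecticForm_apply, ← hgrad]
  constructor
  · rintro rfl v
    rw [toEuclideanLin_structureMatrix_apply_inv]
  · intro h
    rw [← ext_inner_left ℝ h, toEuclideanLin_structureMatrix_inv_apply]

theorem symplecticForm_hamiltonianField (H : PhaseSpace d → ℝ) (y v : PhaseSpace d) :
    symplecticForm d v (hamiltonianField H y) = fderiv ℝ H y v :=
  hamiltonianField_apply_eq_iff.1 rfl v

theorem contDiff_hamiltonianField {H : PhaseSpace d → ℝ} (hH : ContDiff ℝ ∞ H) :
    ContDiff ℝ ∞ (hamiltonianField H) := by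
  have hg : ContDiff ℝ ∞ (∇ H) := by
    rw [contDiff_euclidean]
    intro i
    have : (fun y => ∇ H y i) = fun y => fderiv ℝ H y (EuclideanSpace.single i 1) := by
      funext y
      rw [← InnerProductSpace.toDual_symm_apply, ← gradient, EuclideanSpace.inner_single_right]
      simp
    rw [this]
    exact (contDiff_infty_iff_fderiv.1 hH).2.clm_apply contDiff_const
  exact (Matrix.toEuclideanLin (structureMatrix d)⁻¹).toContinuousLinearMap.contDiff.comp hg

theorem hamiltonianField_sum {s : Finset ℕ} {c : ℕ → ℝ} {K : ℕ → PhaseSpace d → ℝ}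
    (hK : ∀ i ∈ s, ContDiff ℝ ∞ (K i)) :
    hamiltonianField (fun y => ∑ i ∈ s, c i • K i y)
      = fun y => ∑ i ∈ s, c i • hamiltonianField (K i) y := by
  funext y
  refine hamiltonianField_apply_eq_iff.2 fun v => ?_
  have := HasFDerivAt.fun_sum fun i hi =>
    ((hK i hi).differentiable (by simp) y).hasFDerivAt.const_smul (c i)
  rw [show fderiv ℝ (fun y => ∑ i ∈ s, c i • K i y) y = _ from this.fderiv]
  simp [symplecticForm_hamiltonianField]

/-- The derivative of a Hamiltonian field is infinitesimally symplectic: this is the symmetry of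
the Hessian of `H`. -/
theorem symplecticForm_fderiv_hamiltonianField {H : PhaseSpace d → ℝ} (hH : ContDiff ℝ ∞ H)
    (y v w : PhaseSpace d) :
    symplecticForm d (fderiv ℝ (hamiltonianField H) y v) w
      + symplecticForm d v (fderiv ℝ (hamiltonianField H) y w) = 0 := by
  have hd := ((contDiff_hamiltonianField hH).differentiable (by simp) y).hasFDerivAt
  have hd' := ((contDiff_infty_iff_fderiv.1 hH).2.differentiable (by simp) y).hasFDerivAt
  have hsymm : IsSymmSndFDerivAt ℝ H y :=
    hH.contDiffAt.isSymmSndFDerivAt (by simpa using ENat.LEInfty.out)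
  have key : ∀ v w, symplecticForm d v (fderiv ℝ (hamiltonianField H) y w)
      = fderiv ℝ (fderiv ℝ H) y w v := by
    intro v w
    have h1 := (symplecticForm d v).hasFDerivAt.comp y hd
    have h2 := hd'.clm_apply (hasFDerivAt_const v y)
    have h3 : (symplecticForm d v) ∘ hamiltonianField H = fun z => fderiv ℝ H z v :=
      funext fun z => symplecticForm_hamiltonianField H z v
    rw [h3] at h1
    simpa using congrArg (fun L => L w) (h1.unique h2)
  rw [symplecticForm_swap, key, key, hsymm.eq, neg_add_cancel]

/-- A smooth vector field with infinitesimally symplectic derivative is Hamiltonian: the 1-form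
`Ω(·, F)` is closed, hence exact by the Poincaré lemma. -/
theorem exists_eq_hamiltonianField {F : PhaseSpace d → PhaseSpace d} (hF : ContDiff ℝ ∞ F)
    (hΩ : ∀ y v w, symplecticForm d (fderiv ℝ F y v) w + symplecticForm d v (fderiv ℝ F y w) = 0) :
    ∃ K : PhaseSpace d → ℝ, ContDiff ℝ ∞ K ∧ F = hamiltonianField K := by
  set η : PhaseSpace d → PhaseSpace d →L[ℝ] ℝ := fun y => (symplecticForm d).flip (F y)
  have hηs : ContDiff ℝ ∞ η := (symplecticForm d).flip.contDiff.comp hF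
  have hdη : ∀ y x v, fderiv ℝ η y x v = symplecticForm d v (fderiv ℝ F y x) := by
    intro y x v
    have : fderiv ℝ η y = _ := ((symplecticForm d).flip.hasFDerivAt.comp y
      (hF.differentiable (by simp) y).hasFDerivAt).fderiv
    rw [this]
    rfl
  obtain ⟨K, hK⟩ := Convex.exists_forall_hasFDerivAt_of_fderiv_symmetric
    (convex_univ (𝕜 := ℝ) (E := PhaseSpace d)) isOpen_univ
    (hηs.differentiable (by simp)).differentiableOn (fun y _ x v => by
      rw [hdη, hdη, eq_neg_of_add_eq_zero_right (hΩ y v x), ← symplecticForm_swap])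
  have hK' : fderiv ℝ K = η := funext fun y => (hK y trivial).fderiv
  refine ⟨K, contDiff_infty_iff_fderiv.2
    ⟨fun y => (hK y trivial).differentiableAt, hK' ▸ hηs⟩, ?_⟩
  funext y
  exact (hamiltonianField_apply_eq_iff.2 fun v => by rw [hK']; rfl).symm

theorem jacobianMatrix_mulVec (g : PhaseSpace d → PhaseSpace d) (y v : PhaseSpace d) :
    jacobianMatrix g y *ᵥ v.ofLp = (fderiv ℝ g y v).ofLp := by
  have hv : v = ∑ j, v j • EuclideanSpace.single j (1 : ℝ) := by
    simpa using ((EuclideanSpace.basisFun _ ℝ).sum_repr v).symm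
  funext i
  conv_rhs => rw [hv, map_sum]
  simp [jacobianMatrix, Matrix.mulVec, dotProduct, Finset.sum_apply, mul_comm]

theorem IsSymplecticOn.symplecticForm_fderiv {g : PhaseSpace d → PhaseSpace d}
    {U : Set (PhaseSpace d)} (hg : IsSymplecticOn g U) {y : PhaseSpace d} (hy : y ∈ U)
    (v w : PhaseSpace d) :
    symplecticForm d (fderiv ℝ g y v) (fderiv ℝ g y w) = symplecticForm d v w := by
  rw [symplecticForm_eq_dotProduct, symplecticForm_eq_dotProduct, ← jacobianMatrix_mulVec,
    ← jacobianMatrix_mulVec]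
  conv_rhs => rw [← (hg y hy).2]
  rw [← Matrix.mulVec_mulVec, ← Matrix.mulVec_mulVec, Matrix.dotProduct_mulVec _ (_)ᵀ,
    Matrix.vecMul_transpose]

/-- By induction on `M`, the field `f_{M+1}` is Hamiltonian, since the truncated sum of its
predecessors is. -/
theorem Integrator.IsInverseModified.exists_eq_hamiltonianField {Φ : Integrator (PhaseSpace d)}
    (h₁ : ∀ f, ContDiff ℝ ∞ f → ∀ y, Φ.expansionCoeff 1 f y = f y) (hsymp : Φ.IsSymplectic)
    {H : PhaseSpace d → ℝ} (hH : ContDiff ℝ ∞ H) {F : ℕ → PhaseSpace d → PhaseSpace d}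
    (hF : Φ.IsInverseModified (hamiltonianField H) F) (M : ℕ) :
    ∃ K : PhaseSpace d → ℝ, ContDiff ℝ ∞ K ∧ F M = hamiltonianField K := by
  induction M using Nat.strong_induction_on with
  | _ M ih =>
    have hf := contDiff_hamiltonianField hH
    obtain ⟨hs, hm⟩ := Φ.isInverseModified_iff_modifiedSum.1 hF
    choose! K hKs hK using ih
    have htrunc : ∀ s, truncatedField F M s
        = hamiltonianField (fun y => ∑ i ∈ Finset.range M, s ^ i • K i y) := by
      intro s
      rw [hamiltonianField_sum fun i hi => hKs i (Finset.mem_range.1 hi)]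
      funext y
      exact Finset.sum_congr rfl fun i hi => by rw [hK i (Finset.mem_range.1 hi)]
    refine _root_.exists_eq_hamiltonianField (hs M) fun y v w => ?_
    rw [hF.eq_nextField h₁ hf M]
    refine Φ.form_fderiv_nextField (symplecticForm d) hf
      (symplecticForm_fderiv_hamiltonianField hH) (fun i _ => hs i) ?_ (hm M) y v w
    intro s h y hy v w
    have hKsum : ContDiff ℝ ∞ fun y => ∑ i ∈ Finset.range M, s ^ i • K i y :=
      ContDiff.sum fun i hi => (hKs i (Finset.mem_range.1 hi)).const_smul (s ^ i)
    rw [htrunc] at hy ⊢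
    exact (hsymp _ hKsum h).symplecticForm_fderiv hy v w

end Hamiltonian

theorem mainTheorem2 (d : ℕ) (Φ : Integrator (PhaseSpace d))
    (p : ℕ) (hp : 1 ≤ p) (hord : Φ.HasOrder p) (hsymp : Φ.IsSymplectic)
    (H : PhaseSpace d → ℝ) (hH : ContDiff ℝ ∞ H) :
    (∃! F : ℕ → PhaseSpace d → PhaseSpace d, Φ.IsInverseModified (hamiltonianField H) F) ∧
      ∀ F : ℕ → PhaseSpace d → PhaseSpace d, Φ.IsInverseModified (hamiltonianField H) F →
        ∃ K : ℕ → PhaseSpace d → ℝ,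
          ∀ j : ℕ, ContDiff ℝ ∞ (K j) ∧ F j = hamiltonianField (K j) := by
  have hf := contDiff_hamiltonianField hH
  have h₁ : ∀ f, ContDiff ℝ ∞ f → ∀ y, Φ.expansionCoeff 1 f y = f y :=
    fun f hf y => hord.coeff_one hp hf y
  refine ⟨⟨Φ.inverseModified (hamiltonianField H), Φ.isInverseModified_inverseModified h₁ hf,
    fun F hF => hF.eq_inverseModified h₁ hf⟩, fun F hF => ?_⟩
  choose K hK using hF.exists_eq_hamiltonianField h₁ hsymp hH
  exact ⟨K, hK⟩
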